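/- Let $L$ be a finitary first-order vocabulary, let $\mathbf K=(K,\prec_{\mathbf K})$ be an abstract elementary class (AEC) of $L$-structures, and let $LS(\mathbf K)$ be its Löwenheim–Skolem number, that is, the least cardinal $\lambda\ge |L|+\aleph_0$ such that every subset $A$ of every $M\in K$ is contained in some $N\prec_{\mathbf K}M$ with $|N|\le |A|+\lambda$. A $\mathbf K$-embedding $f:M\to N$ is an isomorphism of $M$ onto some $f[M]\prec_{\mathbf K}N$. For an interval $I$ of cardinals, say that $\mathbf K$ satisfies - $JEP(I)$ if any two $M_1,M_2\in K$ with $|M_1|,|M_2|\in I$ can be $\mathbf K$-embedded into a common $N\in K$; - $AP(I)$ if for all $M_0\prec_{\mathbf K}M_1$ and $M_0\prec_{\mathbf K}M_2$ in $K$ with $|M_0|,|M_1|,|M_2|\in I$ there are $N\in K$ and $\mathbf K$-embeddings $g_\ell:M_\ell\to N$ ($\ell=1,2$) with $g_1{\restriction}M_0=g_2{\restriction}M_0$; - $DAP(I)$ if, in the situation of $AP(I)$, $N,g_1,g_2$ can be chosen so that in addition $g_1[M_1]\cap g_2[M_2]=g_1[M_0]$. **Theorem.** Let $\kappa$ be a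 strongly compact cardinal (uncountable, regular, and such that every $\kappa$-complete proper filter on any set extends to a $\kappa$-complete ultrafilter on that set), and let $\mathbf K$ be an AEC with $LS(\mathbf K)<\kappa$. Then for every cardinal $\mu<\kappa$: 1. if $\mathbf K$ satisfies $AP([\mu,\kappa))$, then $\mathbf K$ satisfies $AP([\mu,\infty))$; 2. if $\mathbf K$ satisfies $JEP([\mu,\kappa))$, then $\mathbf K$ satisfies $JEP([\mu,\infty))$; 3. if $\mathbf K$ satisfies $DAP([\mu,\kappa))$, then $\mathbf K$ satisfies $DAP([\mu,\infty))$. In particular (with $\mu=LS(\mathbf K)$) each of $AP$, $JEP$, $DAP$ for models of size in $[LS(\mathbf K),\kappa)$ implies the same property for all models of size at least $LS(\mathbf K)$, and (with $\mu=0$) each of them for all models of size less than $\kappa$ implies the same property for all models in $K$. -/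

import Mathlib

open Cardinal
open scoped FirstOrder

universe u

/-- A class of `L`-structures together with a relation `S ≺ M` between a structure `M` and its
substructures `S`. No axioms are imposed here. -/
structure StrongClass (L : FirstOrder.Language.{u, u}) where
  /-- `M` belongs to the class. -/
  Mem : ∀ (M : Type u) [L.Structure M], Prop
  /-- `S ≺ M`: the substructure `S` is a strong substructure of `M`. -/
  Strong : ∀ {M : Type u} [L.Structure M], L.Substructure M → Prop

namespace StrongClass

variable {L : FirstOrder.Language.{u, u}} (K : StrongClass L)

/-- `S ≺ T` for two substructures of a common ambient `L`-structure `N`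
(which need not belong to the class). -/
def StrongIn {N : Type u} [L.Structure N] (S T : L.Substructure N) : Prop :=
  S ≤ T ∧ K.Strong (S.comap T.subtype.toHom)

/-- `l` is a Löwenheim–Skolem cardinal: it is at least `ℵ₀ + |L|`, and every subset `A` of a
member `M` of the class lies in some `S ≺ M` of cardinality at most `|A| + l`. -/
def IsLSCardinal (l : Cardinal.{u}) : Prop :=
  ℵ₀ ≤ l ∧ L.card ≤ l ∧
    ∀ (M : Type u) [L.Structure M], K.Mem M → ∀ A : Set M,
      ∃ S : L.Substructure M, K.Strong S ∧ A ⊆ (S : Set M) ∧ #S ≤ #A + l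

/-- `⟨S i : i < δ⟩` is a continuous `≺`-increasing chain of substructures of an ambient
`L`-structure `N` (for instance of the union of the chain). -/
structure IsContinuousChain {N : Type u} [L.Structure N] (δ : Ordinal.{u})
    (S : Ordinal.{u} → L.Substructure N) : Prop where
  mem : ∀ i < δ, K.Mem (S i)
  strong : ∀ i j, i ≤ j → j < δ → K.StrongIn (S i) (S j)
  continuous : ∀ j < δ, Order.IsSuccLimit j → S j = ⨆ i : Set.Iio j, S i

end StrongClass

/-- Abstract elementary classes in the vocabulary `L`. -/
structure AEC (L : FirstOrder.Language.{u, u}) extends StrongClass L where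
  /-- The class is closed under isomorphism. -/
  mem_of_equiv : ∀ {M N : Type u} [L.Structure M] [L.Structure N],
    (M ≃[L] N) → Mem M → Mem N
  /-- The relation `≺` is closed under isomorphism. -/
  strong_map_equiv : ∀ {M N : Type u} [L.Structure M] [L.Structure N] (e : M ≃[L] N)
    (S : L.Substructure M), Strong S → Strong (S.map e.toHom)
  /-- `≺` is a relation between members of the class. -/
  mem_of_strong : ∀ {M : Type u} [L.Structure M] (S : L.Substructure M),
    Strong S → Mem S ∧ Mem M
  /-- `≺` is reflexive on the class. -/
  strong_refl : ∀ (M : Type u) [L.Structure M], Mem M → Strong (⊤ : L.Substructure M)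
  /-- `≺` is transitive. -/
  strong_trans : ∀ {M : Type u} [L.Structure M] (S : L.Substructure M) (R : L.Substructure S),
    Strong R → Strong S → Strong (R.map S.subtype.toHom)
  /-- Coherence: if `S ≺ M`, `T ≺ M` and `S ⊆ T`, then `S ≺ T`. -/
  coherence : ∀ {M : Type u} [L.Structure M] (S T : L.Substructure M),
    S ≤ T → Strong S → Strong T → toStrongClass.StrongIn S T
  /-- The union of a continuous chain of limit length belongs to the class. -/
  chain_mem : ∀ {N : Type u} [L.Structure N] (δ : Ordinal.{u})
    (S : Ordinal.{u} → L.Substructure N), Order.IsSuccLimit δ → toStrongClass.IsContinuousChain δ S →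
      Mem (⨆ i : Set.Iio δ, S i : L.Substructure N)
  /-- Every member of a continuous chain of limit length is strong in the union. -/
  chain_strong : ∀ {N : Type u} [L.Structure N] (δ : Ordinal.{u})
    (S : Ordinal.{u} → L.Substructure N), Order.IsSuccLimit δ → toStrongClass.IsContinuousChain δ S →
      ∀ i < δ, toStrongClass.StrongIn (S i) (⨆ i : Set.Iio δ, S i)
  /-- If every member of a continuous chain of limit length is strong in `M`, then so is the
  union. -/
  chain_union_strong : ∀ {M : Type u} [L.Structure M] (δ : Ordinal.{u})
    (S : Ordinal.{u} → L.Substructure M), Order.IsSuccLimit δ → toStrongClass.IsContinuousChain δ S →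
      Mem M → (∀ i < δ, Strong (S i)) → Strong (⨆ i : Set.Iio δ, S i)
  /-- A Löwenheim–Skolem cardinal exists. -/
  exists_isLSCardinal : ∃ l : Cardinal.{u}, toStrongClass.IsLSCardinal l

namespace AEC

variable {L : FirstOrder.Language.{u, u}} (K : AEC L)

/-- The Löwenheim–Skolem number of `K`: the least Löwenheim–Skolem cardinal. -/
noncomputable def LS : Cardinal.{u} :=
  sInf {l | K.IsLSCardinal l}

/-- `f` is a `K`-embedding: an isomorphism of `M` onto a strong substructure of `N`. -/
def IsEmbedding {M N : Type u} [L.Structure M] [L.Structure N] (f : M ↪[L] N) : Prop :=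
  K.Strong f.toHom.range

/-- The joint embedding property for the members of `K` whose cardinality lies in `F`. -/
def JEP (F : Set Cardinal.{u}) : Prop :=
  ∀ (M₁ M₂ : Type u) [L.Structure M₁] [L.Structure M₂],
    K.Mem M₁ → K.Mem M₂ → #M₁ ∈ F → #M₂ ∈ F →
    ∃ (N : Type u) (_ : L.Structure N) (g₁ : M₁ ↪[L] N) (g₂ : M₂ ↪[L] N),
      K.IsEmbedding g₁ ∧ K.IsEmbedding g₂

/-- The amalgamation property for the members of `K` whose cardinality lies in `F`. The inclusions
`M₀ ≺ M₁` and `M₀ ≺ M₂` are given as `K`-embeddings. -/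
def AP (F : Set Cardinal.{u}) : Prop :=
  ∀ (M₀ M₁ M₂ : Type u) [L.Structure M₀] [L.Structure M₁] [L.Structure M₂],
    K.Mem M₀ → K.Mem M₁ → K.Mem M₂ → #M₀ ∈ F → #M₁ ∈ F → #M₂ ∈ F →
    ∀ (f₁ : M₀ ↪[L] M₁) (f₂ : M₀ ↪[L] M₂), K.IsEmbedding f₁ → K.IsEmbedding f₂ →
    ∃ (N : Type u) (_ : L.Structure N) (g₁ : M₁ ↪[L] N) (g₂ : M₂ ↪[L] N),
      K.IsEmbedding g₁ ∧ K.IsEmbedding g₂ ∧ g₁.comp f₁ = g₂.comp f₂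

/-- The disjoint amalgamation property for the members of `K` whose cardinality lies in `F`: the
images of `M₁` and `M₂` meet exactly in the image of `M₀`. -/
def DAP (F : Set Cardinal.{u}) : Prop :=
  ∀ (M₀ M₁ M₂ : Type u) [L.Structure M₀] [L.Structure M₁] [L.Structure M₂],
    K.Mem M₀ → K.Mem M₁ → K.Mem M₂ → #M₀ ∈ F → #M₁ ∈ F → #M₂ ∈ F →
    ∀ (f₁ : M₀ ↪[L] M₁) (f₂ : M₀ ↪[L] M₂), K.IsEmbedding f₁ → K.IsEmbedding f₂ →
    ∃ (N : Type u) (_ : L.Structure N) (g₁ : M₁ ↪[L] N) (g₂ : M₂ ↪[L] N),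
      K.IsEmbedding g₁ ∧ K.IsEmbedding g₂ ∧ g₁.comp f₁ = g₂.comp f₂ ∧
        Set.range g₁ ∩ Set.range g₂ = Set.range (g₁.comp f₁)

end AEC

/-- `κ` is strongly compact: it is uncountable and regular, and every (proper) `κ`-complete filter
on a set `S` extends to a `κ`-complete ultrafilter on `S`. A filter satisfies
`CardinalInterFilter _ κ` when it is closed under intersections of fewer than `κ` sets. -/
def IsStronglyCompact (κ : Cardinal.{u}) : Prop :=
  ℵ₀ < κ ∧ κ.IsRegular ∧
    ∀ (S : Type u) (F : Filter S), F.NeBot → CardinalInterFilter F κ →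
      ∃ U : Ultrafilter S, (U : Filter S) ≤ F ∧ CardinalInterFilter (U : Filter S) κ

/-!
A fine `κ`-complete ultrafilter on the sets of cardinality less than `κ` reduces each of the three
properties to small structures: `M₁` and `M₂` embed into the ultraproduct of the amalgams of their
small strong substructures. Łoś's theorem for `K` is replaced by coherence: a substructure of the
ultraproduct of cardinality less than `κ` is copied by its representatives into almost every factor,
because `κ`-completeness decides all of its fewer than `κ` basic facts at once, and those whose
copies are strong in almost every factor form a directed system, strong in each other, with union
the whole ultraproduct. The axioms for chains extend to such systems by induction on cardinality,
applied to a system indexed by finite sets.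
-/

open FirstOrder.Language Filter

section FinitePowerset

theorem exists_filtration {ι : Type u} (A : Set ι) :
    ∃ B : Ordinal.{u} → Set ι, Monotone B ∧ B (#A).ord = A ∧ (∀ i < (#A).ord, #(B i) < #A) ∧
      ∀ j, Order.IsSuccLimit j → B j = ⋃ i : Set.Iio j, B i := by
  obtain ⟨r, wo, hr⟩ := Cardinal.exists_ord_eq A
  refine ⟨fun i => Subtype.val '' (Ordinal.typein r ⁻¹' Set.Iio i), fun i j hij => ?_, ?_,
    fun i hi => ?_, fun j hj => ?_⟩
  · exact Set.image_mono (Set.preimage_mono (Set.Iio_subset_Iio hij))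
  · have huniv : Ordinal.typein r ⁻¹' Set.Iio (#A).ord = Set.univ :=
      Set.eq_univ_of_forall fun a => hr ▸ Ordinal.typein_lt_type r a
    exact (congrArg (Subtype.val '' ·) huniv).trans (Subtype.coe_image_univ A)
  · rw [Cardinal.mk_image_eq Subtype.val_injective]
    refine lt_of_le_of_lt ?_ (Cardinal.lt_ord.1 hi)
    have hle := Cardinal.mk_preimage_of_injective_lift _ (Set.Iio i) (Ordinal.typein_injective r)
    rwa [Cardinal.mk_Iio_ordinal, Cardinal.lift_lift, Cardinal.lift_le] at hle
  · have hlub : IsLUB (Set.range (Subtype.val : Set.Iio j → Ordinal.{u})) j := by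
      rw [Subtype.range_coe]
      exact hj.isLUB_Iio
    rw [← Set.image_iUnion, ← Set.preimage_iUnion, hlub.iUnion_Iio_eq]

/-- The finite subsets of `A`. They index the directed systems below, because their images under a
monotone map remain directed when `A` shrinks. -/
def finitePowerset {ι : Type*} (A : Set ι) : Set (Finset ι) :=
  {s | ↑s ⊆ A}

theorem finitePowerset_iUnion {ι J : Type*} [Nonempty J] {B : J → Set ι}
    (hB : Directed (· ⊆ ·) B) : finitePowerset (⋃ i, B i) = ⋃ i, finitePowerset (B i) := by
  ext s
  rw [Set.mem_iUnion]
  exact ⟨fun hs => hB.exists_mem_subset_of_finset_subset_biUnion hs,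
    fun ⟨i, hi⟩ => hi.trans (Set.subset_iUnion B i)⟩

theorem exists_monotone_finset_upperBound (ι : Type*) [Preorder ι] [IsDirectedOrder ι]
    [Nonempty ι] : ∃ f : Finset ι → ι, Monotone f ∧ ∀ s, ∀ a ∈ s, a ≤ f s := by
  classical
  have hex (s : Finset ι) (g : (t : Finset ι) → t ⊂ s → ι) :
      ∃ b, (∀ a ∈ s, a ≤ b) ∧ ∀ t (h : t ⊂ s), g t h ≤ b := by
    let g' (t : {t // t ∈ s.ssubsets}) : ι := g t (Finset.mem_ssubsets.1 t.2)
    obtain ⟨b, hb⟩ := Finset.exists_le (s ∪ s.ssubsets.attach.image g')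
    refine ⟨b, fun a ha => hb a (Finset.mem_union_left _ ha), fun t ht => hb _ ?_⟩
    exact Finset.mem_union_right _ (Finset.mem_image.2
      ⟨⟨t, Finset.mem_ssubsets.2 ht⟩, Finset.mem_attach _ _, rfl⟩)
  choose F hFmem hFssub using hex
  have hF (s) := Finset.strongInduction_eq F s
  refine ⟨Finset.strongInduction F, fun t s hts => ?_, fun s a ha => ?_⟩
  · rcases hts.eq_or_lt with rfl | h
    · exact le_rfl
    · rw [hF s]
      exact hFssub s (fun t _ => Finset.strongInduction F t) t h
  · rw [hF s]
    exact hFmem s _ a ha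

end FinitePowerset

section Ultraproduct

variable {I : Type u} (U : Ultrafilter I) {N : I → Type u}

/-- The class of `x` in the ultraproduct of the family `N`. -/
def ultraMk (x : ∀ i, N i) : (U : Filter I).Product N :=
  Quotient.mk'' x

variable {U}

theorem ultraMk_surjective : Function.Surjective (ultraMk U (N := N)) :=
  Quotient.mk''_surjective

theorem ultraMk_eq_iff {x y : ∀ i, N i} : ultraMk U x = ultraMk U y ↔ ∀ᶠ i in U, x i = y i :=
  Quotient.eq''

section Completeness

variable {κ : Cardinal.{u}} [CardinalInterFilter (U : Filter I) κ]

theorem exists_eventually_of_eventually_exists {T : Type u} (hT : #T < κ) {p : I → T → Prop}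
    (h : ∀ᶠ i in U, ∃ t, p i t) : ∃ t, ∀ᶠ i in U, p i t := by
  by_contra! hne
  have hforall : ∀ᶠ i in U, ∀ t, ¬p i t := (eventually_cardinal_forall hT).2 hne
  obtain ⟨i, ⟨t, ht⟩, hi⟩ := (h.and hforall).exists
  exact hi t ht

theorem eventually_forall_iff {T : Type u} (hT : #T < κ) {p : I → T → Prop} {q : T → Prop}
    (h : ∀ t, (∀ᶠ i in U, p i t) ↔ q t) : ∀ᶠ i in U, ∀ t, p i t ↔ q t := by
  refine (eventually_cardinal_forall hT).2 fun t => ?_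
  by_cases ht : q t
  · exact ((h t).2 ht).mono fun i hi => iff_of_true hi ht
  · exact (Ultrafilter.eventually_not.2 (mt (h t).1 ht)).mono fun i hi => iff_of_false hi ht

theorem mk_image_ultraMk_lt {c : Cardinal.{u}} (hc : c < κ) {R : ∀ i, Set (N i)}
    (hR : ∀ i, #(R i) ≤ c) : #(ultraMk U '' {z | ∀ᶠ i in U, z i ∈ R i}) < κ := by
  obtain ⟨T, rfl⟩ : ∃ T : Type u, #T = c := ⟨_, c.mk_out⟩
  have hle (i) : Nonempty (R i ↪ T) := hR i
  let e (i) : R i ↪ T := (hle i).some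
  choose x hxR hx using fun z : ultraMk U '' {z | ∀ᶠ i in U, z i ∈ R i} => z.2
  have hconst (z) : ∃ t, ∀ᶠ i in U, ∃ h, e i ⟨x z i, h⟩ = t :=
    exists_eventually_of_eventually_exists hc ((hxR z).mono fun i h => ⟨_, h, rfl⟩)
  choose pos hpos using hconst
  refine (Cardinal.mk_le_of_injective (f := pos) fun z w hzw => ?_).trans_lt hc
  rw [← Subtype.coe_inj, ← hx z, ← hx w, ultraMk_eq_iff]
  filter_upwards [hpos z, hpos w] with i ⟨_, hz⟩ ⟨_, hw⟩
  exact congrArg Subtype.val ((e i).injective (hz.trans (hzw.trans hw.symm)))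

end Completeness

variable {L : FirstOrder.Language.{u, u}} [∀ i, L.Structure (N i)]

theorem funMap_ultraMk {n : ℕ} (f : L.Functions n) (x : Fin n → ∀ i, N i) :
    Structure.funMap f (fun k => ultraMk U (x k)) =
      ultraMk U fun i => Structure.funMap f fun k => x k i :=
  Ultraproduct.funMap_cast f x

theorem relMap_ultraMk {n : ℕ} (r : L.Relations n) (x : Fin n → ∀ i, N i) :
    Structure.RelMap r (fun k => ultraMk U (x k)) ↔
      ∀ᶠ i in U, Structure.RelMap r fun k => x k i :=
  relMap_quotient_mk' (s := (U : Filter I).productSetoid N) r x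

variable (U) in
/-- The internal substructure of the ultraproduct given by substructures `R i` of the factors, that
is, the canonical copy of the ultraproduct of the `R i`. -/
def ultraSubstructure (R : ∀ i, L.Substructure (N i)) :
    L.Substructure ((U : Filter I).Product N) where
  carrier := ultraMk U '' {z | ∀ᶠ i in U, z i ∈ R i}
  fun_mem f x hx := by
    choose z hz hzx using hx
    obtain rfl : (fun k => ultraMk U (z k)) = x := funext hzx
    rw [funMap_ultraMk]
    exact ⟨_, (eventually_all.2 hz).mono fun i hi => (R i).fun_mem f _ hi, rfl⟩

theorem ultraMk_mem_ultraSubstructure {R : ∀ i, L.Substructure (N i)} {x : ∀ i, N i} :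
    ultraMk U x ∈ ultraSubstructure U R ↔ ∀ᶠ i in U, x i ∈ R i := by
  refine ⟨fun ⟨z, hz, hzx⟩ => ?_, fun hx => ⟨x, hx, rfl⟩⟩
  filter_upwards [hz, ultraMk_eq_iff.1 hzx] with i hzR hzx
  exact hzx ▸ hzR

theorem eventually_range_eq_of_ultraSubstructure {κ : Cardinal.{u}}
    [CardinalInterFilter (U : Filter I) κ] [∀ i, Nonempty (N i)] {R : ∀ i, L.Substructure (N i)}
    (hR : #(ultraSubstructure U R) < κ) {r : ultraSubstructure U R → ∀ i, N i}
    (hr : ∀ s, ultraMk U (r s) = s) : ∀ᶠ i in U, Set.range (fun s => r s i) = R i := by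
  have hle : ∀ᶠ i in U, ∀ s, r s i ∈ R i := (eventually_cardinal_forall hR).2 fun s =>
    ultraMk_mem_ultraSubstructure.1 ((hr s).symm ▸ s.2)
  have hge : ∀ᶠ i in U, ∀ y ∈ R i, ∃ s, r s i = y := by
    by_contra hne
    have hmissed : ∀ᶠ i in U, ∃ y ∈ R i, ∀ s, r s i ≠ y :=
      (Ultrafilter.eventually_not.2 hne).mono fun i hi => by push Not at hi; exact hi
    obtain ⟨z, hz⟩ := skolem.1 hmissed
    have hzR : ultraMk U z ∈ ultraSubstructure U R :=
      ultraMk_mem_ultraSubstructure.2 (hz.mono fun i hi => hi.1)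
    obtain ⟨i, hi, hrz⟩ := (hz.and (ultraMk_eq_iff.1 (hr ⟨_, hzR⟩))).exists
    exact hi.2 _ hrz
  filter_upwards [hle, hge] with i hle hge
  exact Set.Subset.antisymm (Set.range_subset_iff.2 hle) hge

theorem mk_sigma_prod_fin_arrow_lt {κ : Cardinal.{u}} (hκ : ℵ₀ < κ) {F : ℕ → Type u}
    (hF : #(Σ n, F n) < κ) {X : Type u} (hX : #X < κ) : #(Σ n, F n × (Fin n → X)) < κ := by
  let e (x : Σ n, F n × (Fin n → X)) : (Σ n, F n) × List X := (⟨x.1, x.2.1⟩, List.ofFn x.2.2)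
  have he : Function.Injective e := by
    rintro ⟨n, f, x⟩ ⟨m, g, y⟩ h
    obtain ⟨⟨rfl, hfg⟩, hxy⟩ := by simpa only [e, Prod.mk.injEq, Sigma.mk.injEq] using h
    rw [eq_of_heq hfg, List.ofFn_injective hxy]
  refine (Cardinal.mk_le_of_injective he).trans_lt ?_
  rw [Cardinal.mk_prod, Cardinal.lift_id, Cardinal.lift_id]
  exact Cardinal.mul_lt_of_lt hκ.le hF ((Cardinal.mk_list_le_max X).trans_lt (max_lt hκ hX))

theorem eventually_exists_embedding {κ : Cardinal.{u}} [CardinalInterFilter (U : Filter I) κ]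
    (hκ : ℵ₀ < κ) (hL : L.card < κ) {Q : Type u} [L.Structure Q] (hQ : #Q < κ)
    (j : Q ↪[L] (U : Filter I).Product N) {r : Q → ∀ i, N i} (hr : ∀ q, ultraMk U (r q) = j q) :
    ∀ᶠ i in U, ∃ φ : Q ↪[L] N i, ∀ q, φ q = r q i := by
  have hinj : ∀ᶠ i in U, ∀ p : Q × Q, r p.1 i = r p.2 i ↔ p.1 = p.2 := by
    have hQQ : #(Q × Q) < κ := by
      rw [Cardinal.mk_prod, Cardinal.lift_id]
      exact Cardinal.mul_lt_of_lt hκ.le hQ hQ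
    refine eventually_forall_iff hQQ fun p => ?_
    rw [← ultraMk_eq_iff, hr, hr, j.injective.eq_iff]
  have hfun : ∀ᶠ i in U, ∀ x : Σ n, L.Functions n × (Fin n → Q),
      r (Structure.funMap x.2.1 x.2.2) i = Structure.funMap x.2.1 fun k => r (x.2.2 k) i := by
    refine (eventually_cardinal_forall (mk_sigma_prod_fin_arrow_lt hκ
      ((Cardinal.mk_le_of_injective Sum.inl_injective).trans_lt hL) hQ)).2 fun x => ?_
    rw [← ultraMk_eq_iff (y := fun i => Structure.funMap x.2.1 fun k => r (x.2.2 k) i), hr,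
      ← funMap_ultraMk, j.map_fun]
    simp only [hr, Function.comp_def]
  have hrel : ∀ᶠ i in U, ∀ x : Σ n, L.Relations n × (Fin n → Q),
      (Structure.RelMap x.2.1 fun k => r (x.2.2 k) i) ↔ Structure.RelMap x.2.1 x.2.2 := by
    refine eventually_forall_iff (mk_sigma_prod_fin_arrow_lt hκ
      ((Cardinal.mk_le_of_injective Sum.inr_injective).trans_lt hL) hQ) fun x => ?_
    rw [← relMap_ultraMk, ← j.map_rel]
    simp only [hr, Function.comp_def]
  filter_upwards [hinj, hfun, hrel] with i hinj hfun hrel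
  exact ⟨⟨⟨fun q => r q i, fun p q => (hinj (p, q)).1⟩, fun f x => hfun ⟨_, f, x⟩,
    fun f x => hrel ⟨_, f, x⟩⟩, fun q => rfl⟩

theorem exists_embedding_ultraproduct_of_eventually {M : Type u} [L.Structure M]
    {x : M → ∀ i, N i} (hinj : ∀ m m', (∀ᶠ i in U, x m i = x m' i) → m = m')
    (hfun : ∀ (n : ℕ) (f : L.Functions n) (z : Fin n → M), ∀ᶠ i in U,
      x (Structure.funMap f z) i = Structure.funMap f fun k => x (z k) i)
    (hrel : ∀ (n : ℕ) (r : L.Relations n) (z : Fin n → M), ∀ᶠ i in U,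
      (Structure.RelMap r fun k => x (z k) i) ↔ Structure.RelMap r z) :
    ∃ G : M ↪[L] (U : Filter I).Product N, ∀ m, G m = ultraMk U (x m) := by
  refine ⟨⟨⟨fun m => ultraMk U (x m), fun m m' h => hinj m m' (ultraMk_eq_iff.1 h)⟩,
    fun {n} f z => ?_, fun {n} r z => ?_⟩, fun m => rfl⟩
  · exact (ultraMk_eq_iff.2 (hfun n f z)).trans (funMap_ultraMk f fun k => x (z k)).symm
  · exact (relMap_ultraMk r fun k => x (z k)).trans
      ((eventually_congr (hrel n r z)).trans eventually_const)

theorem exists_embedding_ultraproduct [∀ i, Nonempty (N i)] {M : Type u} [L.Structure M]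
    {P : I → L.Substructure M} (hP : ∀ m, ∀ᶠ i in U, m ∈ P i) (g : ∀ i, P i ↪[L] N i) :
    ∃ G : M ↪[L] (U : Filter I).Product N,
      ∀ m x, G m = ultraMk U x ↔ ∀ᶠ i in U, ∃ h : m ∈ P i, g i ⟨m, h⟩ = x i := by
  have hex (m : M) : ∃ x : ∀ i, N i, ∀ᶠ i in U, ∃ h : m ∈ P i, g i ⟨m, h⟩ = x i :=
    have hm : ∀ᶠ i in U, ∃ y, ∃ h : m ∈ P i, g i ⟨m, h⟩ = y := (hP m).mono fun i h => ⟨_, h, rfl⟩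
    skolem.1 hm
  choose x hx using hex
  have hxs {n : ℕ} (z : Fin n → M) :
      ∀ᶠ i in U, ∃ y : Fin n → P i, (∀ k, (y k : M) = z k) ∧ ∀ k, g i (y k) = x (z k) i := by
    filter_upwards [eventually_all.2 fun k => hx (z k)] with i hi
    choose hz hxz using hi
    exact ⟨fun k => ⟨z k, hz k⟩, fun k => rfl, hxz⟩
  obtain ⟨G, hG⟩ : ∃ G : M ↪[L] (U : Filter I).Product N, ∀ m, G m = ultraMk U (x m) := by
    refine exists_embedding_ultraproduct_of_eventually (fun m m' h => ?_) (fun n f z => ?_)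
      fun n r z => ?_
    · obtain ⟨i, h, ⟨_, hxm⟩, ⟨_, hxm'⟩⟩ := (h.and ((hx m).and (hx m'))).exists
      exact congrArg Subtype.val ((g i).injective (hxm.trans (h.trans hxm'.symm)))
    · filter_upwards [hx (Structure.funMap f z), hxs z] with i ⟨_, hxf⟩ ⟨y, hyz, hyx⟩
      obtain rfl : (fun k => (y k : M)) = z := funext hyz
      simp only [← hxf, ← hyx]
      exact (g i).map_fun f y
    · filter_upwards [hxs z] with i ⟨y, hyz, hyx⟩
      obtain rfl : (fun k => (y k : M)) = z := funext hyz
      simp only [← hyx]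
      exact (g i).map_rel r y
  refine ⟨G, fun m y => ?_⟩
  rw [hG, ultraMk_eq_iff]
  exact eventually_congr ((hx m).mono fun i ⟨h, hxm⟩ => by simp [← hxm, h])

end Ultraproduct

section SmallCover

variable {L : FirstOrder.Language.{u, u}}

/-- `D` consists of substructures of cardinality less than `κ` and covers every subset of
cardinality less than `κ`. Such a `D` is directed with union `N`, so that unions of directed systems
apply to it. -/
structure IsSmallCover {N : Type u} [L.Structure N] (κ : Cardinal.{u})
    (D : Set (L.Substructure N)) : Prop where
  card_lt : ∀ S ∈ D, #S < κ
  exists_superset : ∀ A : Set N, #A < κ → ∃ S ∈ D, A ⊆ S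

variable {N : Type u} [L.Structure N] {κ : Cardinal.{u}} {D : Set (L.Substructure N)}

theorem IsSmallCover.nonempty (hD : IsSmallCover κ D) (hκ : ℵ₀ ≤ κ) : D.Nonempty := by
  obtain ⟨S, hS, -⟩ := hD.exists_superset ∅ (by simpa using Cardinal.aleph0_pos.trans_le hκ)
  exact ⟨S, hS⟩

theorem IsSmallCover.directedOn (hD : IsSmallCover κ D) (hκ : ℵ₀ ≤ κ) :
    DirectedOn (· ≤ ·) D := by
  intro S hS T hT
  obtain ⟨R, hR, hST⟩ := hD.exists_superset (S ∪ T) ((Cardinal.mk_union_le _ _).trans_lt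
    (Cardinal.add_lt_of_lt hκ (hD.card_lt S hS) (hD.card_lt T hT)))
  exact ⟨R, hR, Set.subset_union_left.trans hST, Set.subset_union_right.trans hST⟩

theorem IsSmallCover.sSup_eq_top (hD : IsSmallCover κ D) (hκ : ℵ₀ ≤ κ) : sSup D = ⊤ := by
  refine eq_top_iff.2 fun x _ => ?_
  obtain ⟨S, hS, hxS⟩ := hD.exists_superset {x} (by simpa using Cardinal.one_lt_aleph0.trans_le hκ)
  exact (le_sSup hS : S ≤ sSup D) (hxS rfl)

end SmallCover

theorem IsStronglyCompact.exists_fine_ultrafilter {κ : Cardinal.{u}} (hκ : IsStronglyCompact κ)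
    (X : Type u) :
    ∃ U : Ultrafilter {s : Set X // #s < κ}, CardinalInterFilter U.toFilter κ ∧
      ∀ x, ∀ᶠ s in U.toFilter, x ∈ s.1 := by
  obtain ⟨-, hreg, hextend⟩ := hκ
  let F : Filter {s : Set X // #s < κ} :=
    cardinalGenerate (Set.range fun x => {s | x ∈ s.1}) (Cardinal.IsRegular.nat_lt hreg 2)
  have hF : F.NeBot := by
    refine ⟨fun hbot => ?_⟩
    obtain ⟨S, hS, hSκ, hempty⟩ := (mem_cardinalGenerate_iff (hreg := hreg)).1
      (empty_mem_iff_bot.2 hbot)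
    choose x hx using fun s : S => hS s.2
    have hxκ : #(Set.range x) < κ := Cardinal.mk_range_le.trans_lt hSκ
    exact hempty (a := ⟨Set.range x, hxκ⟩) fun s hs => (hx ⟨s, hs⟩).subset ⟨⟨s, hs⟩, rfl⟩
  obtain ⟨U, hUF, hUκ⟩ := hextend _ F hF (cardinalInter_ofCardinalGenerate _ _)
  exact ⟨U, hUκ, fun x => hUF (.basic ⟨x, rfl⟩)⟩

namespace AEC

variable {L : FirstOrder.Language.{u, u}} {K : AEC L}

section Embedding

variable {M N P : Type u} [L.Structure M] [L.Structure N] [L.Structure P]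

theorem IsEmbedding.mem_left {f : M ↪[L] N} (hf : K.IsEmbedding f) : K.Mem M :=
  K.mem_of_equiv f.equivRange.symm (K.mem_of_strong _ hf).1

theorem IsEmbedding.mem_right {f : M ↪[L] N} (hf : K.IsEmbedding f) : K.Mem N :=
  (K.mem_of_strong _ hf).2

theorem isEmbedding_subtype {S : L.Substructure M} : K.IsEmbedding S.subtype ↔ K.Strong S := by
  rw [IsEmbedding, Substructure.range_subtype]

theorem isEmbedding_equiv (e : M ≃[L] N) (hM : K.Mem M) : K.IsEmbedding e.toEmbedding := by
  have hrange : e.toEmbedding.toHom.range = ⊤ := Hom.range_eq_top.2 e.surjective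
  rw [IsEmbedding, hrange]
  exact K.strong_refl N (K.mem_of_equiv e hM)

theorem IsEmbedding.strong_map_iff {f : M ↪[L] N} (hf : K.IsEmbedding f) {S : L.Substructure M} :
    K.Strong (S.map f.toHom) ↔ K.Strong S := by
  have hmap : (S.map f.equivRange.toHom).map f.toHom.range.subtype.toHom = S.map f.toHom :=
    Substructure.map_map ..
  have hcomap : ((S.map f.toHom).comap f.toHom.range.subtype.toHom).map f.equivRange.symm.toHom =
      S := by
    rw [← hmap, Substructure.comap_map_eq_of_injective (Substructure.subtype_injective _),
      Substructure.map_map]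
    convert! S.map_id
    ext x
    exact f.equivRange.symm_apply_apply x
  refine ⟨fun h => ?_, fun h => ?_⟩
  · rw [← hcomap]
    exact K.strong_map_equiv _ _ (K.coherence _ _ Hom.map_le_range h hf).2
  · rw [← hmap]
    exact K.strong_trans _ _ (K.strong_map_equiv _ _ h) hf

theorem IsEmbedding.comp_iff {g : N ↪[L] P} (hg : K.IsEmbedding g) {f : M ↪[L] N} :
    K.IsEmbedding (g.comp f) ↔ K.IsEmbedding f := by
  rw [IsEmbedding, IsEmbedding, ← hg.strong_map_iff, ← Hom.range_comp]
  rfl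

theorem isEmbedding_inclusion {S T : L.Substructure M} (hST : S ≤ T) (hS : K.Strong S)
    (hT : K.Strong T) : K.IsEmbedding (Substructure.inclusion hST) := by
  rwa [← (isEmbedding_subtype.2 hT).comp_iff, Substructure.subtype_comp_inclusion,
    isEmbedding_subtype]

end Embedding

section StrongIn

variable {N : Type u} [L.Structure N] {R S T : L.Substructure N}

theorem strongIn_iff_isEmbedding_inclusion :
    K.StrongIn S T ↔ ∃ h : S ≤ T, K.IsEmbedding (Substructure.inclusion h) := by
  have hrange (h : S ≤ T) : (Substructure.inclusion h).toHom.range = S.comap T.subtype.toHom := by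
    rw [← Substructure.comap_map_eq_of_injective (f := T.subtype.toHom) T.subtype_injective
      (Hom.range _), ← Hom.range_comp]
    exact congrArg _ S.range_subtype
  simp only [StrongClass.StrongIn, IsEmbedding, hrange, exists_prop]

theorem _root_.StrongClass.StrongIn.trans (hRS : K.StrongIn R S) (hST : K.StrongIn S T) :
    K.StrongIn R T := by
  obtain ⟨hRS, hRS'⟩ := strongIn_iff_isEmbedding_inclusion.1 hRS
  obtain ⟨hST, hST'⟩ := strongIn_iff_isEmbedding_inclusion.1 hST
  exact strongIn_iff_isEmbedding_inclusion.2 ⟨hRS.trans hST, hST'.comp_iff.2 hRS'⟩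

theorem _root_.StrongClass.StrongIn.mem_right (h : K.StrongIn S T) : K.Mem T :=
  (K.mem_of_strong _ h.2).2

theorem strongIn_top_iff : K.StrongIn S ⊤ ↔ K.Strong S := by
  refine ⟨fun h => ?_, fun h => K.coherence _ _ le_top h (K.strong_refl _ (K.mem_of_strong _ h).2)⟩
  have hmap := K.strong_map_equiv Substructure.topEquiv _ h.2
  rwa [show Substructure.topEquiv.toHom = (⊤ : L.Substructure N).subtype.toHom from rfl,
    Substructure.map_comap_eq_of_surjective fun x => ⟨⟨x, trivial⟩, rfl⟩] at hmap

end StrongIn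

section StrongLUB

variable {N : Type u} [L.Structure N]

variable (K) in
/-- `T` is a least upper bound of `D` for the relation `≺` between members of `K` that are
substructures of `N`; the ambient structure `N` need not belong to `K`. -/
def IsStrongLUB (D : Set (L.Substructure N)) (T : L.Substructure N) : Prop :=
  (∀ S ∈ D, K.StrongIn S T) ∧
    ∀ Q : L.Substructure N, K.Mem Q → (∀ S ∈ D, K.StrongIn S Q) → K.StrongIn T Q

theorem isStrongLUB_of_mem {D : Set (L.Substructure N)} {T : L.Substructure N} (hT : T ∈ D)
    (h : ∀ S ∈ D, K.StrongIn S T) : K.IsStrongLUB D T :=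
  ⟨h, fun _ _ hQ => hQ T hT⟩

theorem IsStrongLUB.mono {D D' : Set (L.Substructure N)} {T T' : L.Substructure N}
    (hT : K.IsStrongLUB D T) (hT' : K.IsStrongLUB D' T') (hmem : K.Mem T') (h : D ⊆ D') :
    K.StrongIn T T' :=
  hT.2 T' hmem fun S hS => hT'.1 S (h hS)

theorem IsStrongLUB.iUnion {ι : Sort*} {D : ι → Set (L.Substructure N)} {T : ι → L.Substructure N}
    {Q : L.Substructure N} (hT : ∀ i, K.IsStrongLUB (D i) (T i))
    (hQ : K.IsStrongLUB (Set.range T) Q) : K.IsStrongLUB (⋃ i, D i) Q := by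
  refine ⟨fun S hS => ?_, fun R hR hDR => hQ.2 R hR ?_⟩
  · obtain ⟨i, hi⟩ := Set.mem_iUnion.1 hS
    exact ((hT i).1 S hi).trans (hQ.1 _ ⟨i, rfl⟩)
  · rintro _ ⟨i, rfl⟩
    exact (hT i).2 R hR fun S hS => hDR S (Set.mem_iUnion_of_mem i hS)

theorem comap_subtype_iSup {ι : Sort*} {S : ι → L.Substructure N} {T : L.Substructure N}
    (h : ∀ i, S i ≤ T) :
    (⨆ i, S i).comap T.subtype.toHom = ⨆ i, (S i).comap T.subtype.toHom := by
  have hmap {R : L.Substructure N} (hR : R ≤ T) :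
      (R.comap T.subtype.toHom).map T.subtype.toHom = R :=
    le_antisymm Substructure.map_comap_le fun x hx => ⟨⟨x, hR hx⟩, hx, rfl⟩
  apply Substructure.map_injective_of_injective (f := T.subtype.toHom) T.subtype_injective
  simp only [Substructure.map_iSup, hmap (iSup_le h), hmap (h _)]

theorem isStrongLUB_iSup_of_isContinuousChain {δ : Ordinal.{u}}
    {S : Ordinal.{u} → L.Substructure N} (hδ : Order.IsSuccLimit δ)
    (hS : K.IsContinuousChain δ S) :
    K.IsStrongLUB (Set.range fun i : Set.Iio δ => S i) (⨆ i : Set.Iio δ, S i) := by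
  refine ⟨?_, fun Q hQ hSQ => ?_⟩
  · rintro _ ⟨i, rfl⟩
    exact K.chain_strong δ S hδ hS i i.2
  replace hSQ (i) (hi : i < δ) : K.StrongIn (S i) Q := hSQ _ ⟨⟨i, hi⟩, rfl⟩
  have hcomap (j) (hj : j ≤ δ) : (⨆ i : Set.Iio j, S i).comap Q.subtype.toHom =
      ⨆ i : Set.Iio j, (S i).comap Q.subtype.toHom :=
    comap_subtype_iSup fun i => (hSQ i (lt_of_lt_of_le i.2 hj)).1
  have hchain : K.IsContinuousChain δ fun i => (S i).comap Q.subtype.toHom :=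
    { mem := fun i hi => (K.mem_of_strong _ (hSQ i hi).2).1
      strong := fun i j hij hj => K.coherence _ _
        (Substructure.monotone_comap (hS.strong i j hij hj).1)
        (hSQ i (hij.trans_lt hj)).2 (hSQ j hj).2
      continuous := fun j hj hlim => by rw [hS.continuous j hj hlim, hcomap j hj.le] }
  refine ⟨iSup_le fun i => (hSQ i i.2).1, ?_⟩
  rw [hcomap δ le_rfl]
  exact K.chain_union_strong δ (fun i => (S i).comap Q.subtype.toHom) hδ hchain hQ
    fun i hi => (hSQ i hi).2

end StrongLUB

section DirectedUnion

variable {N : Type u} [L.Structure N]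

section Finset

variable {ι : Type u} {S : Finset ι → L.Substructure N}

theorem isStrongLUB_finitePowerset_of_finite (hS : ∀ s t, s ⊆ t → K.StrongIn (S s) (S t))
    {A : Set ι} (hA : A.Finite) :
    K.IsStrongLUB (S '' finitePowerset A) (sSup (S '' finitePowerset A)) := by
  have hle : ∀ R ∈ S '' finitePowerset A, K.StrongIn R (S hA.toFinset) := by
    rintro _ ⟨s, hs, rfl⟩
    exact hS _ _ (hA.subset_toFinset.2 hs)
  have hmem : S hA.toFinset ∈ S '' finitePowerset A := ⟨_, hA.coe_toFinset.le, rfl⟩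
  have hgreatest : IsGreatest (S '' finitePowerset A) (S hA.toFinset) :=
    ⟨hmem, fun R hR => (hle R hR).1⟩
  rw [hgreatest.isLUB.sSup_eq]
  exact isStrongLUB_of_mem hmem hle

theorem isStrongLUB_finitePowerset_of_filtration {B : Ordinal.{u} → Set ι} (hB : Monotone B)
    (hlim : ∀ j, Order.IsSuccLimit j → B j = ⋃ i : Set.Iio j, B i) {δ : Ordinal.{u}}
    (hδ : Order.IsSuccLimit δ) (ih : ∀ i < δ,
      K.IsStrongLUB (S '' finitePowerset (B i)) (sSup (S '' finitePowerset (B i)))) :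
    K.IsStrongLUB (S '' finitePowerset (B δ)) (sSup (S '' finitePowerset (B δ))) := by
  have hpow (j) (hj : Order.IsSuccLimit j) :
      S '' finitePowerset (B j) = ⋃ i : Set.Iio j, S '' finitePowerset (B i) := by
    have : Nonempty (Set.Iio j) := ⟨⟨⊥, hj.bot_lt⟩⟩
    have hdir : Directed (· ⊆ ·) fun i : Set.Iio j => B i :=
      (hB.comp (Subtype.mono_coe _)).directed_le
    rw [hlim j hj, finitePowerset_iUnion hdir, Set.image_iUnion]
  have hsup (j) (hj : Order.IsSuccLimit j) : sSup (S '' finitePowerset (B j)) =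
      ⨆ i : Set.Iio j, sSup (S '' finitePowerset (B i)) := by
    rw [hpow j hj, sSup_iUnion]
  have hmem (i) (hi : i < δ) : K.Mem (sSup (S '' finitePowerset (B i)) : L.Substructure N) :=
    ((ih i hi).1 (S ∅) ⟨∅, by simp [finitePowerset], rfl⟩).mem_right
  have hchain : K.IsContinuousChain δ fun i => sSup (S '' finitePowerset (B i)) :=
    { mem := hmem
      strong := fun i j hij hj => (ih i (hij.trans_lt hj)).mono (ih j hj) (hmem j hj)
        (Set.image_mono fun s hs => hs.trans (hB hij))
      continuous := fun j _ hj => hsup j hj }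
  rw [hsup δ hδ, hpow δ hδ]
  exact IsStrongLUB.iUnion (fun i => ih i i.2) (isStrongLUB_iSup_of_isContinuousChain hδ hchain)

theorem isStrongLUB_finitePowerset (hS : ∀ s t, s ⊆ t → K.StrongIn (S s) (S t)) (A : Set ι) :
    K.IsStrongLUB (S '' finitePowerset A) (sSup (S '' finitePowerset A)) := by
  induction hc : #A using WellFoundedLT.induction generalizing A with
  | ind c ih =>
  subst hc
  rcases lt_or_ge #A ℵ₀ with hA | hA
  · exact isStrongLUB_finitePowerset_of_finite hS (Cardinal.lt_aleph0_iff_set_finite.1 hA)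
  · obtain ⟨B, hBmono, hBA, hBcard, hBlim⟩ := exists_filtration A
    have hlub := isStrongLUB_finitePowerset_of_filtration hBmono hBlim
      (Cardinal.isSuccLimit_ord hA) fun i hi => ih _ (hBcard i hi) (B i) rfl
    rwa [hBA] at hlub

end Finset

/-- Chains suffice: a directed set is the image of the finite subsets of a set `A` under a monotone
map, and induction on `#A` exhausts `A` by a continuous chain of subsets of smaller cardinality. -/
theorem isStrongLUB_sSup_of_directedOn {D : Set (L.Substructure N)} (hne : D.Nonempty)
    (hdir : DirectedOn (· ≤ ·) D) (hD : ∀ S ∈ D, ∀ T ∈ D, S ≤ T → K.StrongIn S T) :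
    K.IsStrongLUB D (sSup D) := by
  have : Nonempty D := hne.to_subtype
  have : IsDirectedOrder D := ⟨directedOn_iff_directed.1 hdir⟩
  obtain ⟨f, hf, hle⟩ := exists_monotone_finset_upperBound D
  let F : Set (L.Substructure N) := (fun s => (f s).1) '' finitePowerset Set.univ
  have hFD : F ⊆ D := by
    rintro _ ⟨s, -, rfl⟩
    exact (f s).2
  have hDF (S) (hS : S ∈ D) : ∃ T ∈ F, S ≤ T :=
    ⟨f {⟨S, hS⟩}, ⟨_, Set.subset_univ _, rfl⟩, hle {⟨S, hS⟩} ⟨S, hS⟩ (Finset.mem_singleton_self _)⟩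
  have hlub : K.IsStrongLUB F (sSup F) := isStrongLUB_finitePowerset
    (fun s t hst => hD _ (f s).2 _ (f t).2 (hf hst)) Set.univ
  have hsup : sSup F = sSup D := le_antisymm (sSup_le_sSup hFD) (sSup_le_sSup_of_isCofinalFor hDF)
  rw [← hsup]
  refine ⟨fun S hS => ?_, fun Q hQ hDQ => hlub.2 Q hQ fun S hS => hDQ S (hFD hS)⟩
  obtain ⟨T, hT, hST⟩ := hDF S hS
  exact (hD S hS T (hFD hT) hST).trans (hlub.1 T hT)

theorem strong_sSup {D : Set (L.Substructure N)} (hne : D.Nonempty) (hdir : DirectedOn (· ≤ ·) D)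
    (hD : ∀ S ∈ D, K.Strong S) : K.Strong (sSup D) := by
  obtain ⟨S, hS⟩ := hne
  have hlub := isStrongLUB_sSup_of_directedOn ⟨S, hS⟩ hdir fun S hS T hT hST =>
    K.coherence S T hST (hD S hS) (hD T hT)
  have htop : K.Mem (⊤ : L.Substructure N) := (strongIn_top_iff.2 (hD S hS)).mem_right
  exact strongIn_top_iff.1 (hlub.2 ⊤ htop fun S hS => strongIn_top_iff.2 (hD S hS))

end DirectedUnion

section LowenheimSkolem

variable {M : Type u} [L.Structure M] {κ μ : Cardinal.{u}}

theorem isLSCardinal_LS : K.IsLSCardinal K.LS :=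
  csInf_mem K.exists_isLSCardinal

theorem aleph0_le_LS : ℵ₀ ≤ K.LS :=
  isLSCardinal_LS.1

theorem card_le_LS : L.card ≤ K.LS :=
  isLSCardinal_LS.2.1

theorem exists_strong_superset (hM : K.Mem M) (A : Set M) :
    ∃ S : L.Substructure M, K.Strong S ∧ A ⊆ S ∧ #S ≤ #A + K.LS :=
  isLSCardinal_LS.2.2 M hM A

theorem exists_strong_superset_mem_Ico (hLS : K.LS < κ) (hμ : μ < κ) (hM : K.Mem M)
    (hμM : μ ≤ #M) {A : Set M} (hA : #A < κ) :
    ∃ S : L.Substructure M, K.Strong S ∧ A ⊆ S ∧ #S ∈ Set.Ico μ κ := by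
  have hκ : ℵ₀ ≤ κ := aleph0_le_LS.trans hLS.le
  obtain ⟨B, rfl⟩ := Cardinal.le_mk_iff_exists_set.1 hμM
  obtain ⟨S, hS, hABS, hcard⟩ := exists_strong_superset hM (A ∪ B)
  have hAB : #(A ∪ B : Set M) < κ :=
    (Cardinal.mk_union_le _ _).trans_lt (Cardinal.add_lt_of_lt hκ hA hμ)
  exact ⟨S, hS, Set.subset_union_left.trans hABS,
    Cardinal.mk_le_mk_of_subset (Set.subset_union_right.trans hABS),
    hcard.trans_lt (Cardinal.add_lt_of_lt hκ hAB hLS)⟩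

theorem isSmallCover_strong (hLS : K.LS < κ) (hM : K.Mem M) :
    IsSmallCover κ {S : L.Substructure M | K.Strong S ∧ #S < κ} where
  card_lt S hS := hS.2
  exists_superset A hA := by
    obtain ⟨S, hS, hAS, hcard⟩ := exists_strong_superset_mem_Ico hLS
      (Cardinal.aleph0_pos.trans_le (aleph0_le_LS.trans hLS.le)) hM zero_le hA
    exact ⟨S, ⟨hS, hcard.2⟩, hAS⟩

theorem isEmbedding_of_strong_map (hLS : K.LS < κ) (hM : K.Mem M) {N : Type u} [L.Structure N]
    {f : M ↪[L] N} (hf : ∀ S : L.Substructure M, K.Strong S → #S < κ → K.Strong (S.map f.toHom)) :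
    K.IsEmbedding f := by
  have hκ : ℵ₀ ≤ κ := aleph0_le_LS.trans hLS.le
  have hcover := isSmallCover_strong hLS hM
  rw [IsEmbedding, Hom.range_eq_map, ← hcover.sSup_eq_top hκ,
    (Substructure.gc_map_comap f.toHom).l_sSup, ← sSup_image]
  refine strong_sSup ((hcover.nonempty hκ).image _) ?_ ?_
  · rintro _ ⟨S, hS, rfl⟩ _ ⟨T, hT, rfl⟩
    obtain ⟨R, hR, hSR, hTR⟩ := hcover.directedOn hκ S hS T hT
    exact ⟨_, ⟨R, hR, rfl⟩, Substructure.monotone_map hSR, Substructure.monotone_map hTR⟩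
  · rintro _ ⟨S, hS, rfl⟩
    exact hf S hS.1 hS.2

end LowenheimSkolem

section Ultraproduct

variable {I : Type u} {U : Ultrafilter I} {N : I → Type u} [∀ i, L.Structure (N i)]
  {κ : Cardinal.{u}}

variable (K κ) in
/-- `S` is a substructure of the ultraproduct of cardinality less than `κ`, and representatives of
its elements are the values of `K`-embeddings of `S` into almost all factors. -/
structure IsLocallyStrong (S : L.Substructure ((U : Filter I).Product N)) : Prop where
  card_lt : #S < κ
  exists_isEmbedding : ∃ r : S → ∀ i, N i, (∀ s, ultraMk U (r s) = s) ∧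
    ∀ᶠ i in U, ∃ φ : S ↪[L] N i, K.IsEmbedding φ ∧ ∀ s, φ s = r s i

variable [CardinalInterFilter (U : Filter I) κ]

theorem IsLocallyStrong.strongIn {S T : L.Substructure ((U : Filter I).Product N)}
    (hS : K.IsLocallyStrong κ S) (hT : K.IsLocallyStrong κ T) (hST : S ≤ T) : K.StrongIn S T := by
  obtain ⟨r, hr, hφ⟩ := hS.exists_isEmbedding
  obtain ⟨r', hr', hφ'⟩ := hT.exists_isEmbedding
  have hrr' : ∀ᶠ i in U, ∀ s : S, r s i = r' (Substructure.inclusion hST s) i :=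
    (eventually_cardinal_forall hS.card_lt).2 fun s =>
      ultraMk_eq_iff.1 ((hr s).trans (hr' (Substructure.inclusion hST s)).symm)
  obtain ⟨i, hrr', ⟨φ, hφ, hφr⟩, ⟨φ', hφ', hφr'⟩⟩ := (hrr'.and (hφ.and hφ')).exists
  have hcomp : φ'.comp (Substructure.inclusion hST) = φ :=
    Embedding.ext fun s => by rw [Embedding.comp_apply, hφr, hφr', hrr']
  exact strongIn_iff_isEmbedding_inclusion.2 ⟨hST, hφ'.comp_iff.1 (hcomp ▸ hφ)⟩

theorem exists_isLocallyStrong_superset (hLS : K.LS < κ) [∀ i, Nonempty (N i)]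
    (hN : ∀ i, K.Mem (N i)) {A : Set ((U : Filter I).Product N)} (hA : #A < κ) :
    ∃ S : L.Substructure ((U : Filter I).Product N), K.IsLocallyStrong κ S ∧ A ⊆ S := by
  choose x hx using fun a : A => ultraMk_surjective a.1
  choose R hR hxR hRcard using fun i =>
    exists_strong_superset (hN i) (Set.range fun a => x a i)
  have hcard : #(ultraSubstructure U R) < κ :=
    mk_image_ultraMk_lt (Cardinal.add_lt_of_lt (aleph0_le_LS.trans hLS.le) hA hLS)
      fun i => (hRcard i).trans (add_le_add_left Cardinal.mk_range_le _)
  choose r hr using fun s : ultraSubstructure U R => ultraMk_surjective s.1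
  refine ⟨ultraSubstructure U R, ⟨hcard, r, hr, ?_⟩, fun a ha => ?_⟩
  · filter_upwards [eventually_exists_embedding (aleph0_le_LS.trans_lt hLS)
      (card_le_LS.trans_lt hLS) hcard (ultraSubstructure U R).subtype hr,
      eventually_range_eq_of_ultraSubstructure hcard hr] with i ⟨φ, hφ⟩ hrange
    refine ⟨φ, ?_, hφ⟩
    have hφR : φ.toHom.range = R i := SetLike.coe_injective
      ((Hom.range_coe _).trans ((congrArg Set.range (funext hφ)).trans hrange))
    rw [IsEmbedding, hφR]
    exact hR i
  · have hxa : ultraMk U (x ⟨a, ha⟩) ∈ ultraSubstructure U R :=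
      ultraMk_mem_ultraSubstructure.2 (Eventually.of_forall fun i => hxR i ⟨_, rfl⟩)
    rwa [hx ⟨a, ha⟩] at hxa

theorem isSmallCover_isLocallyStrong (hLS : K.LS < κ) [∀ i, Nonempty (N i)]
    (hN : ∀ i, K.Mem (N i)) :
    IsSmallCover κ {S : L.Substructure ((U : Filter I).Product N) | K.IsLocallyStrong κ S} where
  card_lt _ hS := hS.card_lt
  exists_superset _ hA := exists_isLocallyStrong_superset hLS hN hA

/-- The ultraproduct is a directed union of its locally strong substructures. -/
theorem IsLocallyStrong.strong (hLS : K.LS < κ) [∀ i, Nonempty (N i)] (hN : ∀ i, K.Mem (N i))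
    {S : L.Substructure ((U : Filter I).Product N)} (hS : K.IsLocallyStrong κ S) : K.Strong S := by
  have hκ : ℵ₀ ≤ κ := aleph0_le_LS.trans hLS.le
  have hcover := isSmallCover_isLocallyStrong (U := U) hLS hN
  have hlub := isStrongLUB_sSup_of_directedOn (hcover.nonempty hκ) (hcover.directedOn hκ)
    fun S hS T hT hST => IsLocallyStrong.strongIn hS hT hST
  rw [hcover.sSup_eq_top hκ] at hlub
  exact strongIn_top_iff.1 (hlub.1 S hS)

theorem isLocallyStrong_map {M : Type u} [L.Structure M] {P : I → L.Substructure M}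
    (hP : ∀ i, K.Strong (P i)) (hPU : ∀ m, ∀ᶠ i in U, m ∈ P i) {g : ∀ i, P i ↪[L] N i}
    (hg : ∀ i, K.IsEmbedding (g i)) {G : M ↪[L] (U : Filter I).Product N}
    (hG : ∀ m x, G m = ultraMk U x → ∀ᶠ i in U, ∃ h : m ∈ P i, g i ⟨m, h⟩ = x i)
    {Q : L.Substructure M} (hQ : K.Strong Q) (hQκ : #Q < κ) :
    K.IsLocallyStrong κ (Q.map G.toHom) := by
  let e := G.substructureEquivMap Q
  have he (s) : G (e.symm s) = s := congrArg Subtype.val (e.apply_symm_apply s)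
  have heQ : K.IsEmbedding e.symm.toEmbedding :=
    isEmbedding_equiv _ (K.mem_of_equiv e (K.mem_of_strong Q hQ).1)
  choose r hr using fun s : Q.map G.toHom => ultraMk_surjective s.1
  have hcard : #(Q.map G.toHom) < κ := e.toEquiv.cardinal_eq ▸ hQκ
  refine ⟨hcard, r, hr, ?_⟩
  have hQP : ∀ᶠ i in U, ∀ q : Q, q.1 ∈ P i := (eventually_cardinal_forall hQκ).2 fun q => hPU q
  have hgr : ∀ᶠ i in U, ∀ s, ∃ h : ↑(e.symm s) ∈ P i, g i ⟨e.symm s, h⟩ = r s i :=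
    (eventually_cardinal_forall hcard).2 fun s => hG _ _ ((he s).trans (hr s).symm)
  filter_upwards [hQP, hgr] with i hQP hgr
  have hle : Q ≤ P i := fun m hm => hQP ⟨m, hm⟩
  exact ⟨((g i).comp (Substructure.inclusion hle)).comp e.symm.toEmbedding,
    ((hg i).comp_iff.2 (isEmbedding_inclusion hle hQ (hP i))).comp_iff.2 heQ,
    fun s => (hgr s).2⟩

theorem exists_isEmbedding_ultraproduct (hLS : K.LS < κ) [∀ i, Nonempty (N i)] {M : Type u}
    [L.Structure M] {P : I → L.Substructure M} (hP : ∀ i, K.Strong (P i))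
    (hPU : ∀ m, ∀ᶠ i in U, m ∈ P i) {g : ∀ i, P i ↪[L] N i} (hg : ∀ i, K.IsEmbedding (g i)) :
    ∃ G : M ↪[L] (U : Filter I).Product N, K.IsEmbedding G ∧
      ∀ m x, G m = ultraMk U x ↔ ∀ᶠ i in U, ∃ h : m ∈ P i, g i ⟨m, h⟩ = x i := by
  obtain ⟨i₀⟩ : Nonempty I := Filter.nonempty_of_neBot (U : Filter I)
  obtain ⟨G, hG⟩ := exists_embedding_ultraproduct hPU g
  refine ⟨G, isEmbedding_of_strong_map hLS (K.mem_of_strong _ (hP i₀)).2 fun Q hQ hQκ => ?_, hG⟩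
  exact (isLocallyStrong_map hP hPU hg (fun m x => (hG m x).1) hQ hQκ).strong hLS
    fun i => (hg i).mem_right

end Ultraproduct

section JointEmbedding

variable {M₁ M₂ : Type u} [L.Structure M₁] [L.Structure M₂] {κ μ : Cardinal.{u}}
  {r s : M₁ → M₂ → Prop}

variable (K) in
/-- There are `K`-embeddings of `M₁` and `M₂` into a common structure that identify all pairs
related by `r` and only pairs related by `s`. Joint embedding, amalgamation and disjoint
amalgamation are the cases of such a requirement with `r`, `s` taken from `⊥`, `⊤` and
`SpanRel`. -/
def JointlyEmbeds (r s : M₁ → M₂ → Prop) : Prop :=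
  ∃ (N : Type u) (_ : L.Structure N) (g₁ : M₁ ↪[L] N) (g₂ : M₂ ↪[L] N),
    K.IsEmbedding g₁ ∧ K.IsEmbedding g₂ ∧
      (∀ a b, r a b → g₁ a = g₂ b) ∧ ∀ a b, g₁ a = g₂ b → s a b

theorem JointlyEmbeds.mono {r' s' : M₁ → M₂ → Prop} (h : K.JointlyEmbeds r s) (hr : r' ≤ r)
    (hs : s ≤ s') : K.JointlyEmbeds r' s' := by
  obtain ⟨N, _, g₁, g₂, hg₁, hg₂, hrg, hgs⟩ := h
  exact ⟨N, _, g₁, g₂, hg₁, hg₂, fun a b hab => hrg a b (hr a b hab),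
    fun a b hab => hs a b (hgs a b hab)⟩

theorem jointlyEmbeds_of_top
    (h : K.JointlyEmbeds (fun (a : (⊤ : L.Substructure M₁)) (b : (⊤ : L.Substructure M₂)) => r a b)
      fun a b => s a b) :
    K.JointlyEmbeds r s := by
  obtain ⟨N, _, g₁, g₂, hg₁, hg₂, hrg, hgs⟩ := h
  have hcomp {M : Type u} [L.Structure M] {g : (⊤ : L.Substructure M) ↪[L] N}
      (hg : K.IsEmbedding g) : K.IsEmbedding (g.comp Substructure.topEquiv.symm.toEmbedding) :=
    hg.comp_iff.2 (isEmbedding_equiv _ (K.mem_of_equiv Substructure.topEquiv hg.mem_left))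
  exact ⟨N, _, _, _, hcomp hg₁, hcomp hg₂, fun a b => hrg ⟨a, trivial⟩ ⟨b, trivial⟩,
    fun a b => hgs ⟨a, trivial⟩ ⟨b, trivial⟩⟩

variable (K κ) in
/-- All subsets of `M₁` and `M₂` of cardinality less than `κ` are contained in strong substructures
that embed jointly, where only the pairs from the two subsets that are related by `r` need to be
identified. This is the input of the compactness argument. -/
def LocallyJointlyEmbeds (r s : M₁ → M₂ → Prop) : Prop :=
  ∀ (A₁ : Set M₁) (A₂ : Set M₂), #A₁ < κ → #A₂ < κ →
    ∃ (P₁ : L.Substructure M₁) (P₂ : L.Substructure M₂), K.Strong P₁ ∧ K.Strong P₂ ∧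
      A₁ ⊆ P₁ ∧ A₂ ⊆ P₂ ∧
      K.JointlyEmbeds (fun (a : P₁) (b : P₂) => ↑a ∈ A₁ ∧ ↑b ∈ A₂ ∧ r a b) fun a b => s a b

theorem LocallyJointlyEmbeds.jointlyEmbeds_of_mk_lt (h : K.LocallyJointlyEmbeds κ r s)
    (hM₁ : #M₁ < κ) (hM₂ : #M₂ < κ) : K.JointlyEmbeds r s := by
  obtain ⟨P₁, P₂, -, -, hP₁, hP₂, h⟩ := h Set.univ Set.univ
    (by rwa [Cardinal.mk_univ]) (by rwa [Cardinal.mk_univ])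
  obtain rfl : P₁ = ⊤ := eq_top_iff.2 hP₁
  obtain rfl : P₂ = ⊤ := eq_top_iff.2 hP₂
  exact jointlyEmbeds_of_top (h.mono (fun a b hab => ⟨trivial, trivial, hab⟩) le_rfl)

theorem LocallyJointlyEmbeds.jointlyEmbeds (hκ : IsStronglyCompact κ) (hLS : K.LS < κ)
    (h : K.LocallyJointlyEmbeds κ r s) : K.JointlyEmbeds r s := by
  rcases isEmpty_or_nonempty (M₁ ⊕ M₂) with hempty | ⟨⟨x₀⟩⟩
  · obtain ⟨_, _⟩ := isEmpty_sum.1 hempty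
    have hpos : 0 < κ := Cardinal.aleph0_pos.trans hκ.1
    exact h.jointlyEmbeds_of_mk_lt (by rwa [Cardinal.mk_eq_zero]) (by rwa [Cardinal.mk_eq_zero])
  obtain ⟨U, _, hU⟩ := hκ.exists_fine_ultrafilter (M₁ ⊕ M₂)
  have hinsert (i : {A : Set (M₁ ⊕ M₂) // #A < κ}) : #(insert x₀ i.1 : Set _) < κ :=
    Cardinal.mk_insert_le.trans_lt
      (Cardinal.add_lt_of_lt hκ.1.le i.2 (Cardinal.one_lt_aleph0.trans hκ.1))
  choose P₁ P₂ hP₁ hP₂ hAP₁ hAP₂ N inst g₁ g₂ hg₁ hg₂ hrg hgs using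
    fun i : {A : Set (M₁ ⊕ M₂) // #A < κ} =>
      h (Sum.inl ⁻¹' insert x₀ i.1) (Sum.inr ⁻¹' insert x₀ i.1)
        ((Cardinal.mk_preimage_of_injective _ _ Sum.inl_injective).trans_lt (hinsert i))
        ((Cardinal.mk_preimage_of_injective _ _ Sum.inr_injective).trans_lt (hinsert i))
  have hNonempty (i) : Nonempty (N i) := by
    rcases x₀ with a | b
    · exact ⟨g₁ i ⟨a, hAP₁ i (Set.mem_insert _ _)⟩⟩
    · exact ⟨g₂ i ⟨b, hAP₂ i (Set.mem_insert _ _)⟩⟩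
  have hU₁ (a) : ∀ᶠ i in U.toFilter, a ∈ Sum.inl ⁻¹' insert x₀ i.1 :=
    (hU (.inl a)).mono fun i => Set.mem_insert_of_mem _
  have hU₂ (b) : ∀ᶠ i in U.toFilter, b ∈ Sum.inr ⁻¹' insert x₀ i.1 :=
    (hU (.inr b)).mono fun i => Set.mem_insert_of_mem _
  obtain ⟨G₁, hG₁, hGg₁⟩ := exists_isEmbedding_ultraproduct (U := U) hLS hP₁
    (fun a => (hU₁ a).mono fun i ha => hAP₁ i ha) hg₁
  obtain ⟨G₂, hG₂, hGg₂⟩ := exists_isEmbedding_ultraproduct (U := U) hLS hP₂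
    (fun b => (hU₂ b).mono fun i hb => hAP₂ i hb) hg₂
  refine ⟨_, _, G₁, G₂, hG₁, hG₂, fun a b hab => ?_, fun a b hab => ?_⟩
  · obtain ⟨x, hx⟩ := ultraMk_surjective (G₂ b)
    rw [← hx, hGg₁]
    filter_upwards [hU₁ a, hU₂ b, (hGg₂ b x).1 hx.symm] with i ha hb ⟨_, hbx⟩
    exact ⟨hAP₁ i ha, (hrg i _ _ ⟨ha, hb, hab⟩).trans hbx⟩
  · obtain ⟨x, hx⟩ := ultraMk_surjective (G₂ b)
    obtain ⟨i, ⟨_, hax⟩, ⟨_, hbx⟩⟩ :=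
      (((hGg₁ a x).1 (hab.trans hx.symm)).and ((hGg₂ b x).1 hx.symm)).exists
    exact hgs i _ _ (hax.trans hbx.symm)

theorem jointlyEmbeds_bot_top_iff : K.JointlyEmbeds (⊥ : M₁ → M₂ → Prop) ⊤ ↔
    ∃ (N : Type u) (_ : L.Structure N) (g₁ : M₁ ↪[L] N) (g₂ : M₂ ↪[L] N),
      K.IsEmbedding g₁ ∧ K.IsEmbedding g₂ := by
  simp [JointlyEmbeds]

theorem jep_Ici (hκ : IsStronglyCompact κ) (hLS : K.LS < κ) (hμ : μ < κ)
    (h : K.JEP (Set.Ico μ κ)) : K.JEP (Set.Ici μ) := by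
  intro M₁ M₂ _ _ hM₁ hM₂ hμM₁ hμM₂
  refine jointlyEmbeds_bot_top_iff.1 (LocallyJointlyEmbeds.jointlyEmbeds hκ hLS ?_)
  intro A₁ A₂ hA₁ hA₂
  obtain ⟨P₁, hP₁, hAP₁, hP₁κ⟩ := exists_strong_superset_mem_Ico hLS hμ hM₁ hμM₁ hA₁
  obtain ⟨P₂, hP₂, hAP₂, hP₂κ⟩ := exists_strong_superset_mem_Ico hLS hμ hM₂ hμM₂ hA₂
  have hP := jointlyEmbeds_bot_top_iff.2
    (h P₁ P₂ (K.mem_of_strong _ hP₁).1 (K.mem_of_strong _ hP₂).1 hP₁κ hP₂κ)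
  exact ⟨P₁, P₂, hP₁, hP₂, hAP₁, hAP₂, hP.mono (fun _ _ hab => hab.2.2) fun _ _ _ => trivial⟩

end JointEmbedding

section Amalgamation

variable {M M₀ M₁ M₂ : Type u} [L.Structure M] [L.Structure M₀] [L.Structure M₁] [L.Structure M₂]
  {κ μ : Cardinal.{u}} {f₁ : M₀ ↪[L] M₁} {f₂ : M₀ ↪[L] M₂}

/-- The relation that identifies the two images of each element of the apex of the span
`M₁ ← M₀ → M₂`. -/
def SpanRel (f₁ : M₀ → M₁) (f₂ : M₀ → M₂) (a : M₁) (b : M₂) : Prop :=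
  ∃ m, f₁ m = a ∧ f₂ m = b

theorem jointlyEmbeds_spanRel_top_iff : K.JointlyEmbeds (SpanRel f₁ f₂) ⊤ ↔
    ∃ (N : Type u) (_ : L.Structure N) (g₁ : M₁ ↪[L] N) (g₂ : M₂ ↪[L] N),
      K.IsEmbedding g₁ ∧ K.IsEmbedding g₂ ∧ g₁.comp f₁ = g₂.comp f₂ := by
  simp [JointlyEmbeds, SpanRel, DFunLike.ext_iff, forall_comm (α := M₁)]

theorem jointlyEmbeds_spanRel_iff : K.JointlyEmbeds (SpanRel f₁ f₂) (SpanRel f₁ f₂) ↔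
    ∃ (N : Type u) (_ : L.Structure N) (g₁ : M₁ ↪[L] N) (g₂ : M₂ ↪[L] N),
      K.IsEmbedding g₁ ∧ K.IsEmbedding g₂ ∧ g₁.comp f₁ = g₂.comp f₂ ∧
        Set.range g₁ ∩ Set.range g₂ = Set.range (g₁.comp f₁) := by
  constructor
  · rintro ⟨N, _, g₁, g₂, hg₁, hg₂, hle, hge⟩
    have hcomm : g₁.comp f₁ = g₂.comp f₂ := Embedding.ext fun m => hle _ _ ⟨m, rfl, rfl⟩
    refine ⟨N, _, g₁, g₂, hg₁, hg₂, hcomm, Set.Subset.antisymm ?_ (Set.subset_inter ?_ ?_)⟩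
    · rintro _ ⟨⟨a, rfl⟩, b, hba⟩
      obtain ⟨m, rfl, -⟩ := hge a b hba.symm
      exact ⟨m, rfl⟩
    · exact Set.range_comp_subset_range f₁ g₁
    · rw [hcomm]
      exact Set.range_comp_subset_range f₂ g₂
  · rintro ⟨N, _, g₁, g₂, hg₁, hg₂, hcomm, hrange⟩
    have hcomm (m) : g₁ (f₁ m) = g₂ (f₂ m) := DFunLike.congr_fun hcomm m
    refine ⟨N, _, g₁, g₂, hg₁, hg₂, ?_, fun a b hab => ?_⟩
    · rintro _ _ ⟨m, rfl, rfl⟩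
      exact hcomm m
    · obtain ⟨m, hm⟩ := hrange.subset ⟨⟨a, rfl⟩, b, hab.symm⟩
      obtain rfl : f₁ m = a := g₁.injective hm
      exact ⟨m, rfl, g₂.injective ((hcomm m).symm.trans hab)⟩

theorem IsEmbedding.exists_small_restriction (hLS : K.LS < κ) {f : M₀ ↪[L] M}
    (hf : K.IsEmbedding f) {P₀ : L.Substructure M₀} (hP₀ : K.Strong P₀) (hP₀κ : #P₀ < κ)
    {A : Set M} (hA : #A < κ) :
    ∃ (P : L.Substructure M) (e : P₀ ↪[L] P), K.Strong P ∧ A ⊆ P ∧ #P < κ ∧ K.IsEmbedding e ∧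
      ∀ m, (e m : M) = f m := by
  have hunion : #(A ∪ f '' P₀ : Set M) < κ := (Cardinal.mk_union_le _ _).trans_lt
    (Cardinal.add_lt_of_lt (aleph0_le_LS.trans hLS.le) hA (Cardinal.mk_image_le.trans_lt hP₀κ))
  obtain ⟨P, ⟨hP, hPκ⟩, hAP⟩ := (isSmallCover_strong hLS hf.mem_right).exists_superset _ hunion
  have hfP (m) : f.domRestrict P₀ m ∈ P := hAP (.inr ⟨m, m.2, rfl⟩)
  refine ⟨P, (f.domRestrict P₀).codRestrict P hfP, hP, Set.subset_union_left.trans hAP, hPκ, ?_,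
    fun m => rfl⟩
  rw [← (isEmbedding_subtype.2 hP).comp_iff, Embedding.subtype_comp_codRestrict]
  exact hf.comp_iff.2 (isEmbedding_subtype.2 hP₀)

theorem jointlyEmbeds_spanRel_of_small (hκ : IsStronglyCompact κ) (hLS : K.LS < κ) (hμ : μ < κ)
    (hμM₀ : μ ≤ #M₀) (hf₁ : K.IsEmbedding f₁) (hf₂ : K.IsEmbedding f₂) {s : M₁ → M₂ → Prop}
    (h : ∀ {P₀ : L.Substructure M₀} {P₁ : L.Substructure M₁} {P₂ : L.Substructure M₂}
      {e₁ : P₀ ↪[L] P₁} {e₂ : P₀ ↪[L] P₂}, #P₀ ∈ Set.Ico μ κ → #P₁ ∈ Set.Ico μ κ →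
      #P₂ ∈ Set.Ico μ κ → K.IsEmbedding e₁ → K.IsEmbedding e₂ → (∀ m, (e₁ m : M₁) = f₁ m) →
      (∀ m, (e₂ m : M₂) = f₂ m) → K.JointlyEmbeds (SpanRel e₁ e₂) fun a b => s a b) :
    K.JointlyEmbeds (SpanRel f₁ f₂) s := by
  refine LocallyJointlyEmbeds.jointlyEmbeds hκ hLS fun A₁ A₂ hA₁ hA₂ => ?_
  obtain ⟨P₀, hP₀, hAP₀, hP₀κ⟩ := exists_strong_superset_mem_Ico hLS hμ hf₁.mem_left hμM₀
    ((Cardinal.mk_preimage_of_injective _ A₁ f₁.injective).trans_lt hA₁)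
  obtain ⟨P₁, e₁, hP₁, hAP₁, hP₁κ, he₁, hef₁⟩ := hf₁.exists_small_restriction hLS hP₀ hP₀κ.2 hA₁
  obtain ⟨P₂, e₂, hP₂, hAP₂, hP₂κ, he₂, hef₂⟩ := hf₂.exists_small_restriction hLS hP₀ hP₀κ.2 hA₂
  have hP := h hP₀κ ⟨hP₀κ.1.trans (Cardinal.mk_le_of_injective e₁.injective), hP₁κ⟩
    ⟨hP₀κ.1.trans (Cardinal.mk_le_of_injective e₂.injective), hP₂κ⟩ he₁ he₂ hef₁ hef₂
  refine ⟨P₁, P₂, hP₁, hP₂, hAP₁, hAP₂, hP.mono ?_ le_rfl⟩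
  rintro ⟨_, _⟩ ⟨_, _⟩ ⟨ha, -, m, rfl, rfl⟩
  exact ⟨⟨m, hAP₀ ha⟩, Subtype.ext (hef₁ _), Subtype.ext (hef₂ _)⟩

theorem ap_Ici (hκ : IsStronglyCompact κ) (hLS : K.LS < κ) (hμ : μ < κ)
    (h : K.AP (Set.Ico μ κ)) : K.AP (Set.Ici μ) := by
  intro M₀ M₁ M₂ _ _ _ _ _ _ hμM₀ _ _ f₁ f₂ hf₁ hf₂
  refine jointlyEmbeds_spanRel_top_iff.1
    (jointlyEmbeds_spanRel_of_small hκ hLS hμ hμM₀ hf₁ hf₂ fun hP₀ hP₁ hP₂ he₁ he₂ _ _ => ?_)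
  exact jointlyEmbeds_spanRel_top_iff.2
    (h _ _ _ he₁.mem_left he₁.mem_right he₂.mem_right hP₀ hP₁ hP₂ _ _ he₁ he₂)

theorem dap_Ici (hκ : IsStronglyCompact κ) (hLS : K.LS < κ) (hμ : μ < κ)
    (h : K.DAP (Set.Ico μ κ)) : K.DAP (Set.Ici μ) := by
  intro M₀ M₁ M₂ _ _ _ _ _ _ hμM₀ _ _ f₁ f₂ hf₁ hf₂
  refine jointlyEmbeds_spanRel_iff.1 (jointlyEmbeds_spanRel_of_small hκ hLS hμ hμM₀ hf₁ hf₂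
    fun hP₀ hP₁ hP₂ he₁ he₂ hef₁ hef₂ => ?_)
  have hamalgam := jointlyEmbeds_spanRel_iff.2
    (h _ _ _ he₁.mem_left he₁.mem_right he₂.mem_right hP₀ hP₁ hP₂ _ _ he₁ he₂)
  refine hamalgam.mono le_rfl ?_
  rintro _ _ ⟨m, rfl, rfl⟩
  exact ⟨m, (hef₁ m).symm, (hef₂ m).symm⟩

end Amalgamation

end AEC

theorem mainTheorem2 {L : FirstOrder.Language.{u, u}} (K : AEC L) (κ μ : Cardinal.{u})
    (hκ : IsStronglyCompact κ) (hLS : K.LS < κ) (hμ : μ < κ) :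
    (K.AP (Set.Ico μ κ) → K.AP (Set.Ici μ)) ∧
    (K.JEP (Set.Ico μ κ) → K.JEP (Set.Ici μ)) ∧
    (K.DAP (Set.Ico μ κ) → K.DAP (Set.Ici μ)) :=
  ⟨AEC.ap_Ici hκ hLS hμ, AEC.jep_Ici hκ hLS hμ, AEC.dap_Ici hκ hLS hμ⟩
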